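/- Let $\mathbf V$ be the universe of sets. An *N3-structure* $\langle\mathbf A,N\rangle$ is a Heyting algebra $\mathbf A=\langle A,\vee,\wedge,\to,0,1\rangle$ ($A$ a set) with a family $N=\{N_x\}_{x\in A}$ of non-empty subsets of $A$ such that for all $x,y\in A$, $x'\in N_x$, $y'\in N_y$: $x'\vee y'\in N_{x\wedge y}$, $x'\wedge y'\in N_{x\vee y}$, $x\in N_{x'}$, $x\wedge y'\in N_{x\to y}$, and $x\wedge x'=0$. It is *complete* if $\mathbf A$ is a complete lattice. Put $\mathbf V_\xi=\{x : x \text{ is a function},\ \mathrm{ran}(x)\subseteq A,\ \mathrm{dom}(x)\subseteq \mathbf V_\zeta\text{ for some }\zeta<\xi\}$ for every ordinal $\xi$, and let $\mathbf V^{\langle\mathbf A,N\rangle}=\bigcup_\xi \mathbf V_\xi$. Let $\mathcal L$ be the first-order language with connectives $\wedge,\vee,\to,\neg$, quantifiers $\exists,\forall$, binary predicates $\in,\approx$, and a constant for every element of $\mathbf V^{\langle\mathbf A,N\rangle}$. A *truth-value mapping* is a map $[\![\cdot]\!]$ from the closed formulas of $\mathcal L$ to $A$ such that, for all $u,v\in\mathbf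 V^{\langle\mathbf A,N\rangle}$, all closed formulas $\varphi,\psi$ and all formulas $\phi(x)$ with at most $x$ free, 1. $[\![u\in v]\!]=\bigvee_{x\in\mathrm{dom}(v)}(v(x)\wedge[\![x\approx u]\!])$; 2. $[\![u\approx v]\!]=\bigwedge_{x\in\mathrm{dom}(u)}(u(x)\to[\![x\in v]\!])\wedge\bigwedge_{x\in\mathrm{dom}(v)}(v(x)\to[\![x\in u]\!])$; 3. $[\![\varphi\mathbin{\#}\psi]\!]=[\![\varphi]\!]\mathbin{\#}[\![\psi]\!]$ for $\#\in\{\wedge,\vee,\to\}$; 4. $[\![\neg\varphi]\!]\in N_{[\![\varphi]\!]}$ and $[\![\neg\neg\varphi]\!]=[\![\varphi]\!]$; 5. $[\![\neg(\varphi\vee\psi)]\!]=[\![\neg\varphi]\!]\wedge[\![\neg\psi]\!]$, $[\![\neg(\varphi\wedge\psi)]\!]=[\![\neg\varphi]\!]\vee[\![\neg\psi]\!]$ and $[\![\neg(\varphi\to\psi)]\!]=[\![\varphi]\!]\wedge[\![\neg\psi]\!]$; 6. $[\![\exists x\,\phi]\!]=\bigvee_{u\in\mathbf V^{\langle\mathbf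 A,N\rangle}}[\![\phi(u)]\!]$ and $[\![\forall x\,\phi]\!]=\bigwedge_{u\in\mathbf V^{\langle\mathbf A,N\rangle}}[\![\phi(u)]\!]$; 7. $[\![u\approx v]\!]\le[\![\neg\phi(u)]\!]\to[\![\neg\phi(v)]\!]$. A closed formula $\varphi$ is *valid* in $\mathbf V^{\langle\mathbf A,N\rangle}$ if $[\![\varphi]\!]=1$. **Claim.** For every complete N3-structure $\langle\mathbf A,N\rangle$ and every truth-value mapping $[\![\cdot]\!]$, all set-theoretic axioms of $ZF_{\mathbf{N3}}$ are valid in $\mathbf V^{\langle\mathbf A,N\rangle}$, that is (with $\alpha\leftrightarrow\beta$ for $(\alpha\to\beta)\wedge(\beta\to\alpha)$, $\exists y\in x\,\varphi$ for $\exists y(y\in x\wedge\varphi)$, and $\forall y\in x\,\varphi$ for $\forall y(y\in x\to\varphi)$): - (Extensionality) $\forall x\forall y[\forall z(z\in x\leftrightarrow z\in y)\to x\approx y]$; - (Pairing) $\forall x\forall y\exists w\forall z[z\in w\leftrightarrow(z\approx x\vee z\approx y)]$; - (Collection) $\forall x[(\forall y\in x\,\exists z\,\phi(y,z))\to\exists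 w\,\forall y\in x\,\exists z\in w\,\phi(y,z)]$; - (Powerset) $\forall x\exists w\forall z[z\in w\leftrightarrow\forall y\in z(y\in x)]$; - (Separation) $\forall x\exists w\forall z[z\in w\leftrightarrow(z\in x\wedge\phi(z))]$; - (Empty set) $\exists x\forall z[z\in x\leftrightarrow\neg(z\approx z)]$; - (Union) $\forall x\exists w\forall z[z\in w\leftrightarrow\exists y\in x(z\in y)]$; - (Infinity) $\exists x[\emptyset\in x\wedge\forall y\in x(y^+\in x)]$, where $\emptyset\in x$ stands for $\exists e\in x\,\forall z[z\in e\leftrightarrow\neg(z\approx z)]$ and $y^+\in x$ for $\exists s\in x\,\forall z[z\in s\leftrightarrow(z\in y\vee z\approx y)]$; - (Induction) $\forall x[(\forall y\in x\,\phi(y))\to\phi(x)]\to\forall x\,\phi(x)$. In the three schemas, $\phi$ is any formula of $\mathcal L$ in which $w$ is not free (and, for Induction, $y$ is not free in $\phi(x)$). Besides the displayed variables it may have further free variables as parameters, over which the axiom is universally closed; in Collection and Separation it may also contain $x$. -/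

import Mathlib

universe u

namespace N3Model

/-! ## Fidel structures -/

/-- The elements of a set `A` of the universe `ZFSet`. (A separate type, so that the only order on
it is the one of the algebra, and not the inclusion of sets.) -/
def Carrier (A : ZFSet.{u}) : Type (u + 1) := {a : ZFSet.{u} // a ∈ A}

/-- `⟨H, {N x}⟩` is a Fidel structure for Nelson's paraconsistent logic N4; `N x` is the set of
admissible values for the negation of a formula of value `x`. -/
structure IsN4Structure {H : Type*} [GeneralizedHeytingAlgebra H] (N : H → Set H) : Prop where
  nonempty : ∀ x, (N x).Nonempty
  sup_mem : ∀ x y, ∀ x' ∈ N x, ∀ y' ∈ N y, x' ⊔ y' ∈ N (x ⊓ y)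
  inf_mem : ∀ x y, ∀ x' ∈ N x, ∀ y' ∈ N y, x' ⊓ y' ∈ N (x ⊔ y)
  symm : ∀ x, ∀ x' ∈ N x, x ∈ N x'
  himp_mem : ∀ x y, ∀ y' ∈ N y, x ⊓ y' ∈ N (x ⇨ y)

/-- A Fidel structure for Nelson's logic N3: an N4-structure which moreover validates
`α → (¬α → β)`, i.e. in which a value and a value of its negation meet in the least element. -/
structure IsN3Structure {H : Type*} [HeytingAlgebra H] (N : H → Set H) : Prop extends
    IsN4Structure N where
  explosion : ∀ x, ∀ x' ∈ N x, x ⊓ x' = ⊥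

/-! ## The universe of names -/

/-- The stage `V_ξ`: the functions `x` with range included in `A` and domain included in `V_ζ` for
some `ζ < ξ`. (`ZFSet.IsFunc d A x` says that `x` is a function from `d` to `A`.) -/
def stage (A : ZFSet.{u}) (ξ : Ordinal.{u}) : Set ZFSet.{u} :=
  {x | ∃ d : ZFSet.{u}, ZFSet.IsFunc d A x ∧ ∃ ζ : Ordinal.{u}, ∃ _ : ζ < ξ, ∀ y ∈ d, y ∈ stage A ζ}
termination_by ξ

/-- The class of names: the union of all the stages. -/
def IsName (A x : ZFSet.{u}) : Prop := ∃ ξ : Ordinal.{u}, x ∈ stage A ξ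

/-- The universe `V^⟨A,N⟩` of names (it depends only on the underlying set `A`). -/
def Name (A : ZFSet.{u}) : Type (u + 1) := {x : ZFSet.{u} // IsName A x}

theorem stage_mono (A : ZFSet.{u}) {ξ η : Ordinal.{u}} (h : ξ ≤ η) : stage A ξ ⊆ stage A η := by
  intro x hx
  rw [stage] at hx ⊢
  obtain ⟨d, hd, ζ, hζ, H⟩ := hx
  exact ⟨d, hd, ζ, lt_of_lt_of_le hζ h, H⟩

/-- A set is a name iff it is a function into `A` whose domain consists of names. -/
theorem isName_iff {A x : ZFSet.{u}} :
    IsName A x ↔ ∃ d : ZFSet.{u}, ZFSet.IsFunc d A x ∧ ∀ y ∈ d, IsName A y := by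
  constructor
  · rintro ⟨ξ, hx⟩
    rw [stage] at hx
    obtain ⟨d, hd, ζ, hζ, H⟩ := hx
    exact ⟨d, hd, fun y hy => ⟨ζ, H y hy⟩⟩
  · rintro ⟨d, hd, H⟩
    choose f hf using fun y : {y : ZFSet.{u} // y ∈ d} => H y.1 y.2
    have hs : Small.{u} {y : ZFSet.{u} // y ∈ d} := ZFSet.small_coe d
    refine ⟨(⨆ i, f i) + 1, ?_⟩
    rw [stage]
    refine ⟨d, hd, ⨆ i, f i, lt_add_one _, fun y hy => ?_⟩
    exact stage_mono A (Ordinal.le_iSup f ⟨y, hy⟩) (hf ⟨y, hy⟩)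

/-- The domain of a name, as a set of names. -/
def Name.dom {A : ZFSet.{u}} (v : Name A) : Set (Name A) :=
  {x | ∃ a : Carrier A, ZFSet.pair x.1 a.1 ∈ v.1}

/-- The value `v(x)` of the name `v` at an element `x` of its domain. -/
noncomputable def Name.app {A : ZFSet.{u}} (v : Name A) (x : v.dom) : Carrier A :=
  x.2.choose

theorem Name.app_spec {A : ZFSet.{u}} (v : Name A) (x : v.dom) :
    ZFSet.pair x.1.1 (v.app x).1 ∈ v.1 :=
  x.2.choose_spec

/-! ## The first-order language -/

/-- Terms of the language with a constant for every name, in the free variables `0, …, n - 1`. -/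
inductive Tm (A : ZFSet.{u}) (n : ℕ) : Type (u + 1)
  | var (i : Fin n) : Tm A n
  | name (a : Name A) : Tm A n

/-- Formulas of the language with a constant for every name, in the free variables
`0, …, n - 1`. The quantifiers of a formula in `n` variables bind the variable `n`. -/
inductive Fml (A : ZFSet.{u}) : ℕ → Type (u + 1)
  | mem {n : ℕ} (s t : Tm A n) : Fml A n
  | eq {n : ℕ} (s t : Tm A n) : Fml A n
  | and {n : ℕ} (φ ψ : Fml A n) : Fml A n
  | or {n : ℕ} (φ ψ : Fml A n) : Fml A n
  | imp {n : ℕ} (φ ψ : Fml A n) : Fml A n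
  | neg {n : ℕ} (φ : Fml A n) : Fml A n
  | ex {n : ℕ} (φ : Fml A (n + 1)) : Fml A n
  | all {n : ℕ} (φ : Fml A (n + 1)) : Fml A n

/-- Closed formulas. -/
abbrev Sentence (A : ZFSet.{u}) : Type (u + 1) := Fml A 0

/-- Substitution in a term. -/
def Tm.subst {A : ZFSet.{u}} {n m : ℕ} (σ : Fin n → Tm A m) : Tm A n → Tm A m
  | .var i => σ i
  | .name a => .name a

/-- A term in `n` variables, read as a term in `n + 1` variables. -/
def Tm.weaken {A : ZFSet.{u}} {n : ℕ} (t : Tm A n) : Tm A (n + 1) :=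
  t.subst fun i => .var i.castSucc

/-- A substitution extended below a quantifier: the bound variable stays bound. -/
def upSubst {A : ZFSet.{u}} {n m : ℕ} (σ : Fin n → Tm A m) : Fin (n + 1) → Tm A (m + 1) :=
  Fin.snoc (α := fun _ => Tm A (m + 1)) (fun i => (σ i).weaken) (.var (Fin.last m))

/-- Simultaneous (capture-avoiding) substitution in a formula. -/
def Fml.subst {A : ZFSet.{u}} : {n m : ℕ} → (Fin n → Tm A m) → Fml A n → Fml A m
  | _, _, σ, .mem s t => .mem (s.subst σ) (t.subst σ)
  | _, _, σ, .eq s t => .eq (s.subst σ) (t.subst σ)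
  | _, _, σ, .and φ ψ => .and (φ.subst σ) (ψ.subst σ)
  | _, _, σ, .or φ ψ => .or (φ.subst σ) (ψ.subst σ)
  | _, _, σ, .imp φ ψ => .imp (φ.subst σ) (ψ.subst σ)
  | _, _, σ, .neg φ => .neg (φ.subst σ)
  | _, _, σ, .ex φ => .ex (φ.subst (upSubst σ))
  | _, _, σ, .all φ => .all (φ.subst (upSubst σ))

/-- `φ(u)`: the name `u` is put for the last variable of `φ`. -/
def Fml.inst {A : ZFSet.{u}} {n : ℕ} (φ : Fml A (n + 1)) (a : Name A) : Fml A n :=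
  φ.subst (Fin.snoc (α := fun _ => Tm A n) Tm.var (.name a))

/-- `φ` with a variable that does not occur in it inserted at position `w`: the variables of `φ`
from position `w` on are renamed to their successors. -/
def Fml.skip {A : ZFSet.{u}} {n : ℕ} (w : Fin (n + 1)) (φ : Fml A n) : Fml A (n + 1) :=
  φ.subst fun i => .var (w.succAbove i)

/-- `φ ↔ ψ`, i.e. `(φ → ψ) ∧ (ψ → φ)`. -/
def Fml.iff {A : ZFSet.{u}} {n : ℕ} (φ ψ : Fml A n) : Fml A n := .and (.imp φ ψ) (.imp ψ φ)

/-- `∃ y ∈ t, φ`, i.e. `∃ y (y ∈ t ∧ φ)`, where `y` is the variable `n`. -/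
def Fml.exIn {A : ZFSet.{u}} {n : ℕ} (t : Tm A n) (φ : Fml A (n + 1)) : Fml A n :=
  .ex (.and (.mem (.var (Fin.last n)) t.weaken) φ)

/-- `∀ y ∈ t, φ`, i.e. `∀ y (y ∈ t → φ)`, where `y` is the variable `n`. -/
def Fml.allIn {A : ZFSet.{u}} {n : ℕ} (t : Tm A n) (φ : Fml A (n + 1)) : Fml A n :=
  .all (.imp (.mem (.var (Fin.last n)) t.weaken) φ)

/-- The universal closure of a formula. -/
def Fml.closure {A : ZFSet.{u}} : {n : ℕ} → Fml A n → Sentence A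
  | 0, φ => φ
  | _ + 1, φ => Fml.closure (.all φ)

/-- The variable `i`. -/
abbrev v {A : ZFSet.{u}} {n : ℕ} (i : ℕ) (h : i < n := by omega) : Tm A n := .var ⟨i, h⟩

/-! ## The set-theoretic axioms

Numbers are the variables. In a schema, the variables `0, …, k - 1` are parameters and `k, k + 1, …`
are the variables displayed in the schema. -/

section Axioms

variable (A : ZFSet.{u})

/-- `∀x ∀y [∀z (z ∈ x ↔ z ∈ y) → x ≈ y]`, with `x, y, z = 0, 1, 2`. -/
def extensionality : Sentence A :=
  .all (.all (.imp (.all (.iff (.mem (v 2) (v 0)) (.mem (v 2) (v 1)))) (.eq (v 0) (v 1))))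

/-- `∀x ∀y ∃w ∀z [z ∈ w ↔ (z ≈ x ∨ z ≈ y)]`, with `x, y, w, z = 0, 1, 2, 3`. -/
def pairing : Sentence A :=
  .all (.all (.ex (.all
    (.iff (.mem (v 3) (v 2)) (.or (.eq (v 3) (v 0)) (.eq (v 3) (v 1)))))))

/-- `∀x ∃w ∀z [z ∈ w ↔ ∀y ∈ z (y ∈ x)]`, with `x, w, z, y = 0, 1, 2, 3`. -/
def powerset : Sentence A :=
  .all (.ex (.all (.iff (.mem (v 2) (v 1)) (.allIn (v 2) (.mem (v 3) (v 0))))))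

/-- `∀x ∃w ∀z [z ∈ w ↔ ∃y ∈ x (z ∈ y)]`, with `x, w, z, y = 0, 1, 2, 3`. -/
def union : Sentence A :=
  .all (.ex (.all (.iff (.mem (v 2) (v 1)) (.exIn (v 0) (.mem (v 2) (v 3))))))

/-- `t` is the empty set: `∀z [z ∈ t ↔ ¬(z ≈ z)]`. -/
def isEmpty {A : ZFSet.{u}} {n : ℕ} (t : Tm A n) : Fml A n :=
  .all (.iff (.mem (v n) t.weaken) (.neg (.eq (v n) (v n))))

/-- `s` is `t⁺ = t ∪ {t}`: `∀z [z ∈ s ↔ (z ∈ t ∨ z ≈ t)]`. -/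
def isSucc {A : ZFSet.{u}} {n : ℕ} (s t : Tm A n) : Fml A n :=
  .all (.iff (.mem (v n) s.weaken) (.or (.mem (v n) t.weaken) (.eq (v n) t.weaken)))

/-- `∃x ∀z [z ∈ x ↔ ¬(z ≈ z)]`. -/
def emptySet : Sentence A := .ex (isEmpty (v 0))

/-- `∃x [∅ ∈ x ∧ ∀y ∈ x (y⁺ ∈ x)]`, where `∅ ∈ x` is written out as `∃e ∈ x (e is empty)` and
`y⁺ ∈ x` as `∃s ∈ x (s is y⁺)`; `x = 0`, `e = y = 1`, `s = 2`. -/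
def infinity : Sentence A :=
  .ex (.and (.exIn (v 0) (isEmpty (v 1))) (.allIn (v 0) (.exIn (v 0) (isSucc (v 2) (v 1)))))

variable {A}

/-- `∀x ∃w ∀z [z ∈ w ↔ (z ∈ x ∧ φ(z))]`, for `φ` in the parameters, `x = k` and `z = k + 1`;
on the right `x, w, z = k, k + 1, k + 2`. -/
def separation {k : ℕ} (φ : Fml A (k + 2)) : Sentence A :=
  Fml.closure (n := k) (.all (.ex (.all
    (.iff (.mem (v (k + 2)) (v (k + 1)))
      (.and (.mem (v (k + 2)) (v k)) (φ.skip ⟨k + 1, by omega⟩))))))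

/-- `∀x [(∀y ∈ x ∃z φ(y,z)) → ∃w ∀y ∈ x ∃z ∈ w φ(y,z)]`, for `φ` in the parameters, `x = k`,
`y = k + 1` and `z = k + 2`; after `∃w`, `w, y, z = k + 1, k + 2, k + 3`. -/
def collection {k : ℕ} (φ : Fml A (k + 3)) : Sentence A :=
  Fml.closure (n := k) (.all (.imp
    (.allIn (v k) (.ex φ))
    (.ex (.allIn (v k) (.exIn (v (k + 1)) (φ.skip ⟨k + 1, by omega⟩))))))

/-- `∀x [(∀y ∈ x φ(y)) → φ(x)] → ∀x φ(x)`, for `φ` in the parameters and `x = k`;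
on the left `y = k + 1`. -/
def induction {k : ℕ} (φ : Fml A (k + 1)) : Sentence A :=
  Fml.closure (n := k) (.imp
    (.all (.imp (.allIn (v k) (φ.skip ⟨k, by omega⟩)) φ))
    (.all φ))

variable (A)

/-- The set-theoretic axioms of `ZF_N3`. The schemas range over all formulas of the language with
`∧, ∨, →, ¬, ∃, ∀`, with parameters, and with constants for the names. -/
inductive ZFAxiom : Sentence A → Prop
  | extensionality : ZFAxiom (extensionality A)
  | pairing : ZFAxiom (pairing A)
  | collection {k : ℕ} (φ : Fml A (k + 3)) : ZFAxiom (collection φ)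
  | powerset : ZFAxiom (powerset A)
  | separation {k : ℕ} (φ : Fml A (k + 2)) : ZFAxiom (separation φ)
  | emptySet : ZFAxiom (emptySet A)
  | union : ZFAxiom (union A)
  | infinity : ZFAxiom (infinity A)
  | induction {k : ℕ} (φ : Fml A (k + 1)) : ZFAxiom (induction φ)

end Axioms

/-! ## Truth values -/

/-- `val` is a truth-value mapping `⟦·⟧` of `V^⟨A,N⟩`. The value of a negation is not determined by
the value of the formula, only restricted by `N` and by the clauses below. -/
structure IsTruthValue {A : ZFSet.{u}} [Order.Frame (Carrier A)]
    (N : Carrier A → Set (Carrier A)) (val : Sentence A → Carrier A) : Prop where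
  mem : ∀ a b : Name A, val (.mem (.name a) (.name b)) =
    ⨆ x : b.dom, b.app x ⊓ val (.eq (.name x.1) (.name a))
  eq : ∀ a b : Name A, val (.eq (.name a) (.name b)) =
    (⨅ x : a.dom, a.app x ⇨ val (.mem (.name x.1) (.name b))) ⊓
      ⨅ x : b.dom, b.app x ⇨ val (.mem (.name x.1) (.name a))
  and : ∀ φ ψ : Sentence A, val (.and φ ψ) = val φ ⊓ val ψ
  or : ∀ φ ψ : Sentence A, val (.or φ ψ) = val φ ⊔ val ψ
  imp : ∀ φ ψ : Sentence A, val (.imp φ ψ) = val φ ⇨ val ψ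
  neg_mem : ∀ φ : Sentence A, val (.neg φ) ∈ N (val φ)
  neg_neg : ∀ φ : Sentence A, val (.neg (.neg φ)) = val φ
  neg_or : ∀ φ ψ : Sentence A, val (.neg (.or φ ψ)) = val (.neg φ) ⊓ val (.neg ψ)
  neg_and : ∀ φ ψ : Sentence A, val (.neg (.and φ ψ)) = val (.neg φ) ⊔ val (.neg ψ)
  neg_imp : ∀ φ ψ : Sentence A, val (.neg (.imp φ ψ)) = val φ ⊓ val (.neg ψ)
  ex : ∀ φ : Fml A 1, val (.ex φ) = ⨆ a : Name A, val (φ.inst a)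
  all : ∀ φ : Fml A 1, val (.all φ) = ⨅ a : Name A, val (φ.inst a)
  leibniz_neg : ∀ (φ : Fml A 1) (a b : Name A),
    val (.eq (.name a) (.name b)) ≤ val (.neg (φ.inst a)) ⇨ val (.neg (φ.inst b))

/-- A sentence is valid if its truth value is the greatest element. -/
def Valid {A : ZFSet.{u}} [Order.Frame (Carrier A)] (val : Sentence A → Carrier A)
    (φ : Sentence A) : Prop := val φ = ⊤

end N3Model

/-! This is the Heyting-valued model argument, with negation entering at two points only. The
Leibniz law for negations, applied to `¬φ` together with `⟦¬¬φ⟧ = ⟦φ⟧`, shows that the value of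
every formula is an extensional function of each name put for a variable (`extensional_inst`).
Explosion together with `⟦z ≈ z⟧ = 1` gives `⟦¬(z ≈ z)⟧ = 0`, which is needed for Empty set and
Infinity.

For extensional predicates, a quantifier bounded by a name `b` reduces to the small set `b.dom`
(`iSup_memv_inf`, `iInf_memv_himp`). If an extensional `P` is supported by a small set `S` of names,
then the name with domain `S` and value `P s` at `s` satisfies `⟦a ∈ w⟧ = P a` for all `a`
(`exists_memv_eq`). Pairing, Union, Powerset, Separation and Empty set then amount to finding `S`.
Collection uses that `A` is a set, Infinity iterates the successor, Induction is recursion on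
domains, and Extensionality is the clause for `≈`. -/

namespace N3Model

/-! ## Substitution -/

section Substitution

variable {A : ZFSet.{u}} {n m l : ℕ}

theorem Tm.subst_subst (σ : Fin n → Tm A m) (τ : Fin m → Tm A l) (t : Tm A n) :
    (t.subst σ).subst τ = t.subst fun i => (σ i).subst τ := by
  cases t <;> rfl

theorem Tm.subst_var (t : Tm A n) : t.subst Tm.var = t := by
  cases t <;> rfl

theorem Tm.weaken_subst_snoc (t : Tm A n) (σ : Fin n → Tm A m) (s : Tm A m) :
    t.weaken.subst (Fin.snoc (α := fun _ => Tm A m) σ s) = t.subst σ := by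
  cases t <;> simp [Tm.weaken, Tm.subst]

theorem Tm.weaken_subst_up (t : Tm A n) (σ : Fin n → Tm A m) :
    t.weaken.subst (upSubst σ) = (t.subst σ).weaken := by
  rw [upSubst, Tm.weaken_subst_snoc]
  cases t <;> rfl

theorem upSubst_comp (σ : Fin n → Tm A m) (τ : Fin m → Tm A l) :
    (fun i => (upSubst σ i).subst (upSubst τ)) = upSubst fun i => (σ i).subst τ := by
  funext i
  refine Fin.lastCases ?_ (fun j => ?_) i
  · simp [upSubst, Tm.subst]
  · have h : upSubst σ j.castSucc = (σ j).weaken := by simp [upSubst]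
    rw [h, Tm.weaken_subst_up]
    simp [upSubst]

theorem Fml.subst_subst (φ : Fml A n) : ∀ {m l : ℕ} (σ : Fin n → Tm A m) (τ : Fin m → Tm A l),
    (φ.subst σ).subst τ = φ.subst fun i => (σ i).subst τ := by
  induction φ with
  | mem s t => intros; simp [Fml.subst, Tm.subst_subst]
  | eq s t => intros; simp [Fml.subst, Tm.subst_subst]
  | and φ ψ hφ hψ => intros; simp [Fml.subst, hφ, hψ]
  | or φ ψ hφ hψ => intros; simp [Fml.subst, hφ, hψ]
  | imp φ ψ hφ hψ => intros; simp [Fml.subst, hφ, hψ]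
  | neg φ hφ => intros; simp [Fml.subst, hφ]
  | ex φ hφ => intros; simp [Fml.subst, hφ, upSubst_comp]
  | all φ hφ => intros; simp [Fml.subst, hφ, upSubst_comp]

/-- The quantifier clauses speak of formulas with one free variable. This carries them over to
formulas with parameters, once names have been put for the parameters. -/
theorem Fml.inst_subst_up (φ : Fml A (n + 1)) (σ : Fin n → Tm A m) (a : Name A) :
    (φ.subst (upSubst σ)).inst a =
      φ.subst (Fin.snoc (α := fun _ => Tm A m) σ (.name a)) := by
  rw [Fml.inst, Fml.subst_subst]
  congr 1
  funext i
  refine Fin.lastCases ?_ (fun j => ?_) i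
  · simp [upSubst, Tm.subst]
  · simp [upSubst, Tm.weaken_subst_snoc, Tm.subst_var]

theorem Fml.subst_var (φ : Fml A n) : φ.subst Tm.var = φ := by
  have up : ∀ k : ℕ, upSubst (A := A) (n := k) Tm.var = Tm.var := fun k => by
    funext i
    refine Fin.lastCases ?_ (fun j => ?_) i <;> simp [upSubst, Tm.weaken, Tm.subst]
  induction φ <;> simp_all [Fml.subst, Tm.subst_var]

end Substitution

/-! ## Values under an assignment -/

section Values

variable {A : ZFSet.{u}} {n m : ℕ}

/-- The name denoted by a term under an assignment. -/
def Tm.eval (ρ : Fin n → Name A) : Tm A n → Name A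
  | .var i => ρ i
  | .name a => a

/-- The assignment `ρ`, extended by the value `a` of a new last variable. -/
def extend (ρ : Fin n → Name A) (a : Name A) : Fin (n + 1) → Name A :=
  Fin.snoc (α := fun _ => Name A) ρ a

/-- The value of a formula under an assignment of names to its free variables. -/
def Fml.eval (val : Sentence A → Carrier A) (ρ : Fin n → Name A) (φ : Fml A n) : Carrier A :=
  val (φ.subst fun i => .name (ρ i))

theorem Tm.subst_name (ρ : Fin n → Name A) (t : Tm A n) :
    t.subst (fun i => (.name (ρ i) : Tm A m)) = .name (t.eval ρ) := by
  cases t <;> rfl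

@[simp] theorem extend_last (ρ : Fin n → Name A) (a : Name A) : extend ρ a (Fin.last n) = a := by
  simp [extend]

@[simp] theorem extend_castSucc (ρ : Fin n → Name A) (a : Name A) (i : Fin n) :
    extend ρ a i.castSucc = ρ i := by
  simp [extend]

/-- The axioms name their variables by numerals, that is, as `⟨i, h⟩` and not through `Fin.last` and
`castSucc`; hence these variants of the two preceding lemmas. -/
theorem extend_mk_self (ρ : Fin n → Name A) (a : Name A) (h : n < n + 1) :
    extend ρ a ⟨n, h⟩ = a :=
  extend_last ρ a

theorem extend_mk_lt (ρ : Fin n → Name A) (a : Name A) {i : ℕ} (h : i < n + 1) (hi : i < n) :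
    extend ρ a ⟨i, h⟩ = ρ ⟨i, hi⟩ :=
  extend_castSucc ρ a ⟨i, hi⟩

@[simp] theorem Tm.eval_weaken (ρ : Fin n → Name A) (a : Name A) (t : Tm A n) :
    t.weaken.eval (extend ρ a) = t.eval ρ := by
  cases t <;> simp [Tm.weaken, Tm.subst, Tm.eval]

@[simp] theorem Tm.eval_var (ρ : Fin n → Name A) (i : Fin n) : (Tm.var i).eval ρ = ρ i := rfl

theorem Fml.eval_subst (val : Sentence A → Carrier A) (ρ : Fin m → Name A) (σ : Fin n → Tm A m)
    (φ : Fml A n) : (φ.subst σ).eval val ρ = φ.eval val fun i => (σ i).eval ρ := by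
  simp only [Fml.eval, Fml.subst_subst, Tm.subst_name]

theorem Fml.eval_skip (val : Sentence A → Carrier A) (w : Fin (n + 1)) (ρ : Fin (n + 1) → Name A)
    (φ : Fml A n) : (φ.skip w).eval val ρ = φ.eval val fun i => ρ (w.succAbove i) :=
  Fml.eval_subst val ρ _ φ

/-- Skipping the last but one variable. -/
theorem Fml.eval_skip_extend (val : Sentence A → Carrier A) (ρ : Fin n → Name A) (a b : Name A)
    (φ : Fml A (n + 1)) (h : n < n + 2) :
    (φ.skip ⟨n, h⟩).eval val (extend (extend ρ a) b) = φ.eval val (extend ρ b) := by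
  rw [Fml.eval_skip]
  congr 1
  funext i
  refine Fin.lastCases ?_ (fun j => ?_) i
  · rw [Fin.succAbove_of_le_castSucc _ _ (by simp [Fin.le_def])]
    simp
  · rw [Fin.succAbove_of_castSucc_lt _ _ (by simp [Fin.lt_def])]
    simp

/-- Skipping the last variable but two. -/
theorem Fml.eval_skip_extend_extend (val : Sentence A → Carrier A) (ρ : Fin n → Name A)
    (a b c : Name A) (φ : Fml A (n + 2)) (h : n < n + 3) :
    (φ.skip ⟨n, h⟩).eval val (extend (extend (extend ρ a) b) c) =
      φ.eval val (extend (extend ρ b) c) := by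
  rw [Fml.eval_skip]
  congr 1
  funext i
  refine Fin.lastCases ?_ (fun j => ?_) i
  · rw [Fin.succAbove_of_le_castSucc _ _ (by simp [Fin.le_def])]
    simp
  refine Fin.lastCases ?_ (fun j => ?_) j
  · rw [Fin.succAbove_of_le_castSucc _ _ (by simp [Fin.le_def])]
    simp [← Fin.castSucc_succ]
  · rw [Fin.succAbove_of_castSucc_lt _ _ (by simp [Fin.lt_def])]
    simp

end Values

/-! ### Truth-value clauses under an assignment -/

namespace IsTruthValue

variable {A : ZFSet.{u}} [Order.Frame (Carrier A)] {N : Carrier A → Set (Carrier A)}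
  {val : Sentence A → Carrier A} {n : ℕ}

theorem eval_and (hval : IsTruthValue N val) (ρ : Fin n → Name A) (φ ψ : Fml A n) :
    (φ.and ψ).eval val ρ = φ.eval val ρ ⊓ ψ.eval val ρ := hval.and _ _

theorem eval_or (hval : IsTruthValue N val) (ρ : Fin n → Name A) (φ ψ : Fml A n) :
    (φ.or ψ).eval val ρ = φ.eval val ρ ⊔ ψ.eval val ρ := hval.or _ _

theorem eval_imp (hval : IsTruthValue N val) (ρ : Fin n → Name A) (φ ψ : Fml A n) :
    (φ.imp ψ).eval val ρ = φ.eval val ρ ⇨ ψ.eval val ρ := hval.imp _ _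

theorem eval_ex (hval : IsTruthValue N val) (ρ : Fin n → Name A) (φ : Fml A (n + 1)) :
    φ.ex.eval val ρ = ⨆ a, φ.eval val (extend ρ a) := by
  rw [Fml.eval, Fml.subst, hval.ex]
  refine iSup_congr fun a => ?_
  rw [Fml.inst_subst_up, Fml.eval]
  congr 2
  funext i
  refine Fin.lastCases ?_ (fun j => ?_) i <;> simp

theorem eval_all (hval : IsTruthValue N val) (ρ : Fin n → Name A) (φ : Fml A (n + 1)) :
    φ.all.eval val ρ = ⨅ a, φ.eval val (extend ρ a) := by
  rw [Fml.eval, Fml.subst, hval.all]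
  refine iInf_congr fun a => ?_
  rw [Fml.inst_subst_up, Fml.eval]
  congr 2
  funext i
  refine Fin.lastCases ?_ (fun j => ?_) i <;> simp

/-- A formula that has the greatest value under every assignment has a valid closure. -/
theorem valid_closure (hval : IsTruthValue N val) {n : ℕ} (φ : Fml A n)
    (h : ∀ ρ, φ.eval val ρ = ⊤) : Valid val φ.closure := by
  induction n with
  | zero =>
    have := h Fin.elim0
    rwa [Fml.eval, Subsingleton.elim (fun i : Fin 0 => (Tm.name _ : Tm A 0)) Tm.var,
      Fml.subst_var] at this
  | succ n ih =>
    refine ih _ fun ρ => ?_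
    rw [hval.eval_all, iInf_eq_top]
    exact fun a => h _

end IsTruthValue

/-! ## Membership and equality of names -/

section Atomic

variable {A : ZFSet.{u}}

/-- The value of `a ≈ b`. -/
def eqv (val : Sentence A → Carrier A) (a b : Name A) : Carrier A := val (.eq (.name a) (.name b))

/-- The value of `a ∈ b`. -/
def memv (val : Sentence A → Carrier A) (a b : Name A) : Carrier A :=
  val (.mem (.name a) (.name b))

theorem Fml.eval_eq {n : ℕ} (val : Sentence A → Carrier A) (ρ : Fin n → Name A) (s t : Tm A n) :
    (Fml.eq s t).eval val ρ = eqv val (s.eval ρ) (t.eval ρ) := by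
  simp only [Fml.eval, Fml.subst, Tm.subst_name, eqv]

theorem Fml.eval_mem {n : ℕ} (val : Sentence A → Carrier A) (ρ : Fin n → Name A) (s t : Tm A n) :
    (Fml.mem s t).eval val ρ = memv val (s.eval ρ) (t.eval ρ) := by
  simp only [Fml.eval, Fml.subst, Tm.subst_name, memv]

/-- `Name.app` picks a value by choice; a name is a function, so there is only one to pick. -/
theorem Name.app_eq_of_pair_mem (v : Name A) (x : v.dom) (a : Carrier A)
    (h : ZFSet.pair x.1.1 a.1 ∈ v.1) : v.app x = a := by
  obtain ⟨d, hd, H⟩ := isName_iff.1 v.2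
  have hx : x.1.1 ∈ d := (ZFSet.pair_mem_prod.1 (hd.1 h)).1
  exact Subtype.ext ((hd.2 _ hx).unique (v.app_spec x) h)

instance small_carrier : Small.{u} (Carrier A) := ZFSet.small_coe A

/-- The map `x ↦ (x, v(x))` injects the domain into the set `v`. Smallness is what allows a
collection of names to be the domain of a new name. -/
instance small_dom (v : Name A) : Small.{u} v.dom :=
  small_of_injective (β := v.1) (f := fun x : v.dom => ⟨ZFSet.pair x.1.1 (v.app x).1, v.app_spec x⟩)
    fun _ _ h => Subtype.ext (Subtype.ext (ZFSet.pair_inj.1 (Subtype.ext_iff.1 h)).1)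

/-- Induction on the domain of a name. -/
theorem Name.induction {p : Name A → Prop} (h : ∀ v : Name A, (∀ x ∈ v.dom, p x) → p v)
    (v : Name A) : p v := by
  obtain ⟨v, hv⟩ := v
  obtain ⟨ξ, hξ⟩ := hv
  induction ξ using WellFoundedLT.induction generalizing v with
  | ind ξ ih =>
    refine h _ fun x hx => ?_
    obtain ⟨a, ha⟩ := hx
    rw [stage] at hξ
    obtain ⟨d, hd, ζ, hζ, H⟩ := hξ
    exact ih ζ hζ x.1 (H _ (ZFSet.pair_mem_prod.1 (hd.1 ha)).1)

/-- The name with a given small domain and given values. -/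
noncomputable def Name.mk (S : Set (Name A)) [Small.{u} S] (p : S → Carrier A) : Name A :=
  ⟨ZFSet.range fun s : S => ZFSet.pair s.1.1 (p s).1, isName_iff.2
    ⟨ZFSet.range fun s : S => s.1.1, by
      constructor
      · intro z hz
        obtain ⟨s, rfl⟩ := ZFSet.mem_range.1 hz
        exact ZFSet.pair_mem_prod.2 ⟨ZFSet.mem_range.2 ⟨s, rfl⟩, (p s).2⟩
      · intro z hz
        obtain ⟨s, rfl⟩ := ZFSet.mem_range.1 hz
        refine ⟨(p s).1, ZFSet.mem_range.2 ⟨s, rfl⟩, fun b hb => ?_⟩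
        obtain ⟨t, ht⟩ := ZFSet.mem_range.1 hb
        obtain ⟨h1, rfl⟩ := ZFSet.pair_inj.1 ht
        rw [Subtype.ext (Subtype.ext h1)], by
      intro y hy
      obtain ⟨s, rfl⟩ := ZFSet.mem_range.1 hy
      exact s.1.2⟩⟩

variable {S : Set (Name A)} [Small.{u} S] {p : S → Carrier A}

theorem Name.pair_mem_mk {x : Name A} {a : Carrier A} :
    ZFSet.pair x.1 a.1 ∈ (Name.mk S p).1 ↔ ∃ h : x ∈ S, p ⟨x, h⟩ = a := by
  refine ZFSet.mem_range.trans ⟨?_, ?_⟩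
  · rintro ⟨s, hs⟩
    obtain ⟨h1, h2⟩ := ZFSet.pair_inj.1 hs
    obtain rfl : s.1 = x := Subtype.ext h1
    exact ⟨s.2, Subtype.ext h2⟩
  · rintro ⟨h, rfl⟩
    exact ⟨⟨x, h⟩, rfl⟩

theorem Name.mem_dom_mk {x : Name A} : x ∈ (Name.mk S p).dom ↔ x ∈ S :=
  ⟨fun ⟨_, ha⟩ => (Name.pair_mem_mk.1 ha).1, fun h => ⟨p ⟨x, h⟩, Name.pair_mem_mk.2 ⟨h, rfl⟩⟩⟩

theorem Name.app_mk (x : (Name.mk S p).dom) :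
    (Name.mk S p).app x = p ⟨x.1, Name.mem_dom_mk.1 x.2⟩ :=
  Name.app_eq_of_pair_mem _ x _ (Name.pair_mem_mk.2 ⟨Name.mem_dom_mk.1 x.2, rfl⟩)

end Atomic

end N3Model

namespace N3Model

/-! ### Extensional predicates and the names that represent them -/

section Extensional

variable {A : ZFSet.{u}} [Order.Frame (Carrier A)] {N : Carrier A → Set (Carrier A)}
  {val : Sentence A → Carrier A}

/-- A predicate on names, with values in `A`, that respects `≈`. -/
def Extensional (val : Sentence A → Carrier A) (P : Name A → Carrier A) : Prop :=
  ∀ a b, eqv val a b ⊓ P a ≤ P b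

theorem Extensional.inf {P Q : Name A → Carrier A} (hP : Extensional val P)
    (hQ : Extensional val Q) : Extensional val fun a => P a ⊓ Q a := fun a b =>
  le_inf ((inf_le_inf_left _ inf_le_left).trans (hP a b))
    ((inf_le_inf_left _ inf_le_right).trans (hQ a b))

theorem Extensional.sup {P Q : Name A → Carrier A} (hP : Extensional val P)
    (hQ : Extensional val Q) : Extensional val fun a => P a ⊔ Q a := fun a b => by
  rw [inf_sup_left]
  exact sup_le_sup (hP a b) (hQ a b)

theorem Extensional.iSup {ι : Sort*} {P : ι → Name A → Carrier A}
    (hP : ∀ i, Extensional val (P i)) : Extensional val fun a => ⨆ i, P i a := fun a b => by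
  rw [inf_iSup_eq]
  exact iSup_mono fun i => hP i a b

namespace IsTruthValue

theorem eqv_comm (hval : IsTruthValue N val) (a b : Name A) : eqv val a b = eqv val b a := by
  rw [eqv, eqv, hval.eq, hval.eq, inf_comm]

theorem memv_eq (hval : IsTruthValue N val) (a b : Name A) :
    memv val a b = ⨆ x : b.dom, b.app x ⊓ eqv val x a := hval.mem a b

theorem eqv_self (hval : IsTruthValue N val) (a : Name A) : eqv val a a = ⊤ := by
  induction a using Name.induction with
  | h a ih =>
    -- By induction `⟦x ≈ x⟧ = 1`, so the term of index `x` in the join for `⟦x ∈ a⟧` is `a(x)`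
    -- itself.
    have h : ∀ x : a.dom, a.app x ≤ memv val x a := fun x => by
      rw [hval.memv_eq]
      exact le_iSup_of_le x (by rw [ih _ x.2, inf_top_eq])
    rw [eqv, hval.eq, inf_idem, iInf_eq_top]
    exact fun x => himp_eq_top_iff.2 (h x)

theorem app_le_memv (hval : IsTruthValue N val) (a : Name A) (x : a.dom) :
    a.app x ≤ memv val x a := by
  rw [hval.memv_eq]
  exact le_iSup_of_le x (by rw [hval.eqv_self, inf_top_eq])

/-- The value of every formula respects `≈`: the Leibniz law for negations, applied to a negation,
gives it for all formulas. -/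
theorem extensional_inst (hval : IsTruthValue N val) (φ : Fml A 1) :
    Extensional val fun a => val (φ.inst a) := fun a b => by
  have h := hval.leibniz_neg φ.neg a b
  have e : ∀ c, φ.neg.inst c = (φ.inst c).neg := fun c => rfl
  rwa [e, e, hval.neg_neg, hval.neg_neg, le_himp_iff] at h

theorem extensional_eval (hval : IsTruthValue N val) {n : ℕ} (φ : Fml A (n + 1))
    (ρ : Fin n → Name A) : Extensional val fun a => φ.eval val (extend ρ a) := by
  have h := hval.extensional_inst (φ.subst (upSubst fun i => .name (ρ i)))
  have e : ∀ a, φ.eval val (extend ρ a) = val ((φ.subst (upSubst fun i => .name (ρ i))).inst a) := by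
    intro a
    rw [Fml.inst_subst_up, Fml.eval]
    congr 2
    funext i
    refine Fin.lastCases ?_ (fun j => ?_) i <;> simp
  simpa only [e] using h

/-- Collection needs extensionality in the last variable but one. Putting the constant `c` for the
last variable makes it the last. -/
theorem extensional_eval_extend (hval : IsTruthValue N val) {n : ℕ} (φ : Fml A (n + 2))
    (ρ : Fin n → Name A) (c : Name A) :
    Extensional val fun a => φ.eval val (extend (extend ρ a) c) := by
  have h := hval.extensional_eval
    (φ.subst (Fin.snoc (α := fun _ => Tm A (n + 1)) Tm.var (.name c))) ρ
  have e : ∀ a, φ.eval val (extend (extend ρ a) c) =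
      (φ.subst (Fin.snoc (α := fun _ => Tm A (n + 1)) Tm.var (.name c))).eval val (extend ρ a) := by
    intro a
    rw [Fml.eval_subst]
    congr 1
    funext i
    refine Fin.lastCases ?_ (fun j => ?_) i <;> simp [Tm.eval]
  simpa only [e] using h

/-- The Leibniz law replaces the usual simultaneous induction on names for the equality axioms;
`extensional_eqv_left` is transitivity of `≈`. -/
theorem extensional_memv_left (hval : IsTruthValue N val) (c : Name A) :
    Extensional val fun a => memv val a c :=
  hval.extensional_inst (.mem (.var 0) (.name c))

theorem extensional_memv_right (hval : IsTruthValue N val) (c : Name A) :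
    Extensional val fun a => memv val c a :=
  hval.extensional_inst (.mem (.name c) (.var 0))

theorem extensional_eqv_left (hval : IsTruthValue N val) (c : Name A) :
    Extensional val fun a => eqv val a c :=
  hval.extensional_inst (.eq (.var 0) (.name c))

/-- Bounded existential quantification. -/
theorem iSup_memv_inf (hval : IsTruthValue N val) {P : Name A → Carrier A}
    (hP : Extensional val P) (b : Name A) :
    ⨆ a, memv val a b ⊓ P a = ⨆ x : b.dom, b.app x ⊓ P x := by
  refine le_antisymm (iSup_le fun a => ?_) (iSup_le fun x => ?_)
  · rw [hval.memv_eq, iSup_inf_eq]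
    refine iSup_mono fun x => ?_
    rw [inf_assoc, hval.eqv_comm]
    exact inf_le_inf_left _ (hP _ _)
  · exact le_iSup_of_le x.1 (inf_le_inf_right _ (hval.app_le_memv b x))

/-- Bounded universal quantification. -/
theorem iInf_memv_himp (hval : IsTruthValue N val) {P : Name A → Carrier A}
    (hP : Extensional val P) (b : Name A) :
    ⨅ a, (memv val a b ⇨ P a) = ⨅ x : b.dom, (b.app x ⇨ P x) := by
  refine le_antisymm (le_iInf fun x => ?_) (le_iInf fun a => ?_)
  · exact iInf_le_of_le x.1 (himp_le_himp_right (hval.app_le_memv b x))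
  · rw [le_himp_iff, hval.memv_eq, inf_iSup_eq]
    refine iSup_le fun x => ?_
    rw [← inf_assoc]
    refine le_trans ?_ (hP x a)
    rw [inf_comm]
    exact inf_le_inf_left _ (le_himp_iff.1 (iInf_le _ x))

theorem memv_mk (hval : IsTruthValue N val) {S : Set (Name A)} [Small.{u} S] {p : S → Carrier A}
    (a : Name A) : memv val a (Name.mk S p) = ⨆ s : S, p s ⊓ eqv val s a := by
  rw [hval.memv_eq]
  refine le_antisymm (iSup_le fun x => ?_) (iSup_le fun s => ?_)
  · rw [Name.app_mk]
    exact le_iSup (fun s : S => p s ⊓ eqv val s a) ⟨x.1, Name.mem_dom_mk.1 x.2⟩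
  · refine le_iSup_of_le ⟨s.1, Name.mem_dom_mk.2 s.2⟩ ?_
    rw [Name.app_mk]

theorem app_le_memv_mk (hval : IsTruthValue N val) {S : Set (Name A)} [Small.{u} S]
    {p : S → Carrier A} (s : S) : p s ≤ memv val s (Name.mk S p) := by
  rw [hval.memv_mk]
  exact le_iSup_of_le s (by rw [hval.eqv_self, inf_top_eq])

/-- An extensional predicate `P` has the values `⟦z ∈ w⟧` for a name `w`, if `P` is supported by a
small set of names. -/
theorem exists_memv_eq (hval : IsTruthValue N val) {P : Name A → Carrier A}
    (hP : Extensional val P) (S : Set (Name A)) [Small.{u} S]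
    (h : ∀ a, P a ≤ ⨆ s : S, P s ⊓ eqv val s a) : ∃ w, ∀ a, memv val a w = P a := by
  refine ⟨Name.mk S fun s => P s, fun a => ?_⟩
  rw [hval.memv_mk]
  refine le_antisymm (iSup_le fun s => ?_) (h a)
  -- `P s ⊓ ⟦s ≈ a⟧ ≤ P a` is extensionality; the converse inequality was the support hypothesis.
  rw [inf_comm]
  exact hP s a

/-- A predicate that implies membership in a name is supported by the domain of that name. -/
theorem exists_memv_eq_of_le (hval : IsTruthValue N val) {P : Name A → Carrier A}
    (hP : Extensional val P) (b : Name A) (h : ∀ a, P a ≤ memv val a b) :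
    ∃ w, ∀ a, memv val a w = P a := by
  refine hval.exists_memv_eq hP b.dom fun a => ?_
  calc P a ≤ memv val a b ⊓ P a := le_inf (h a) le_rfl
    _ = ⨆ x : b.dom, b.app x ⊓ eqv val x a ⊓ P a := by rw [hval.memv_eq, iSup_inf_eq]
    _ ≤ _ := iSup_mono fun x => le_inf ?_ (inf_le_left.trans inf_le_right)
  rw [inf_assoc, hval.eqv_comm]
  exact inf_le_right.trans (hP a x)

/-! ### Names witnessing the set-existence axioms -/

theorem exists_empty (hval : IsTruthValue N val) : ∃ w : Name A, ∀ a, memv val a w = ⊥ :=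
  hval.exists_memv_eq (P := fun _ => ⊥) (fun _ _ => inf_le_right) ∅ fun _ => bot_le

theorem exists_pair (hval : IsTruthValue N val) (x y : Name A) :
    ∃ w, ∀ a, memv val a w = eqv val a x ⊔ eqv val a y := by
  refine hval.exists_memv_eq
    ((hval.extensional_eqv_left x).sup (hval.extensional_eqv_left y)) {x, y} fun a => ?_
  refine sup_le (le_iSup_of_le ⟨x, by simp⟩ ?_) (le_iSup_of_le ⟨y, by simp⟩ ?_)
  · simp [hval.eqv_self, hval.eqv_comm x a]
  · simp [hval.eqv_self, hval.eqv_comm y a]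

theorem exists_union (hval : IsTruthValue N val) (x : Name A) :
    ∃ w, ∀ a, memv val a w = ⨆ y, memv val y x ⊓ memv val a y := by
  -- Restricting the join to `y ∈ x.dom` makes the support, the union of the domains of these `y`,
  -- small.
  have e : ∀ a, ⨆ y, memv val y x ⊓ memv val a y = ⨆ y : x.dom, x.app y ⊓ memv val a y :=
    fun a => hval.iSup_memv_inf (hval.extensional_memv_right a) x
  have hP : Extensional val fun a => ⨆ y : x.dom, x.app y ⊓ memv val a y :=
    Extensional.iSup fun y => Extensional.inf (fun _ _ => inf_le_right)
      (hval.extensional_memv_left _)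
  simp only [e]
  refine hval.exists_memv_eq hP (⋃ y : x.dom, y.1.dom) fun a => iSup_le fun y => ?_
  rw [hval.memv_eq, inf_iSup_eq]
  refine iSup_le fun z => ?_
  refine le_iSup_of_le ⟨z.1, Set.mem_iUnion.2 ⟨y, z.2⟩⟩ ?_
  rw [← inf_assoc]
  exact inf_le_inf_right _ (le_iSup_of_le y (inf_le_inf_left _ (hval.app_le_memv _ z)))

theorem exists_succ (hval : IsTruthValue N val) (x : Name A) :
    ∃ w, ∀ a, memv val a w = memv val a x ⊔ eqv val a x := by
  refine hval.exists_memv_eq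
    ((hval.extensional_memv_left x).sup (hval.extensional_eqv_left x))
    ({x} ∪ x.dom) fun a => sup_le ?_ ?_
  · rw [hval.memv_eq]
    refine iSup_le fun y => le_iSup_of_le ⟨y.1, Or.inr y.2⟩ ?_
    exact inf_le_inf_right _ ((hval.app_le_memv x y).trans le_sup_left)
  · refine le_iSup_of_le ⟨x, Or.inl rfl⟩ ?_
    simp [hval.eqv_self, hval.eqv_comm x a]

/-- The clause for `≈` only concerns the domains, where `a(x) ≤ ⟦x ∈ a⟧`. With `c` the value of the
premise, this is Extensionality. -/
theorem le_eqv (hval : IsTruthValue N val) {c : Carrier A} {a b : Name A}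
    (h : ∀ z, c ⊓ memv val z a ≤ memv val z b) (h' : ∀ z, c ⊓ memv val z b ≤ memv val z a) :
    c ≤ eqv val a b := by
  rw [eqv, hval.eq]
  refine le_inf (le_iInf fun x => le_himp_iff.2 ?_) (le_iInf fun x => le_himp_iff.2 ?_)
  · exact (inf_le_inf_left _ (hval.app_le_memv a x)).trans (h x)
  · exact (inf_le_inf_left _ (hval.app_le_memv b x)).trans (h' x)

/-- To the degree that `a` is a subset of `x`, it equals its trace on `x.dom`. Traces are given by
functions `x.dom → A`, so they form a small set, which supports the predicate. -/
theorem exists_powerset (hval : IsTruthValue N val) (x : Name A) :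
    ∃ w, ∀ a, memv val a w = ⨅ y, (memv val y a ⇨ memv val y x) := by
  have hP : Extensional val fun a => ⨅ y, (memv val y a ⇨ memv val y x) := by
    intro a b
    refine le_iInf fun y => le_himp_iff.2 ?_
    have h1 : eqv val a b ⊓ memv val y b ≤ memv val y a := by
      rw [hval.eqv_comm]
      exact hval.extensional_memv_right y b a
    calc _ ≤ (⨅ y, (memv val y a ⇨ memv val y x)) ⊓ memv val y a :=
          le_inf (inf_le_left.trans inf_le_right)
            ((inf_le_inf_right _ inf_le_left).trans h1)
      _ ≤ _ := le_himp_iff.1 (iInf_le _ y)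
  refine hval.exists_memv_eq hP (Set.range fun f : x.dom → Carrier A => Name.mk x.dom f)
    fun a => ?_
  -- The trace of `a`. Only the inclusion of `a` in `b` uses the value of `a ⊆ x`; that of `b` in
  -- `a` holds outright.
  set b := Name.mk x.dom fun y => memv val y a with hb
  have key : ⨅ y, (memv val y a ⇨ memv val y x) ≤ eqv val a b := by
    refine hval.le_eqv (fun z => ?_) fun z => inf_le_right.trans ?_
    · calc _ ≤ memv val z x ⊓ memv val z a :=
            le_inf (le_himp_iff.1 (iInf_le _ z)) inf_le_right
        _ = ⨆ t : x.dom, x.app t ⊓ eqv val t z ⊓ memv val z a := by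
            rw [hval.memv_eq, iSup_inf_eq]
        _ ≤ _ := by
            rw [hb, hval.memv_mk]
            refine iSup_mono fun t => le_inf ?_ (inf_le_left.trans inf_le_right)
            rw [inf_assoc, hval.eqv_comm]
            exact inf_le_right.trans (hval.extensional_memv_left a z t)
    · rw [hb, hval.memv_mk]
      refine iSup_le fun t => ?_
      rw [inf_comm]
      exact hval.extensional_memv_left a t z
  refine le_iSup_of_le ⟨b, _, rfl⟩ (le_inf ?_ ?_)
  · exact (le_inf key le_rfl).trans (hP a b)
  · rwa [hval.eqv_comm]

/-- Collection, for a predicate `P y z` that is extensional in `y`. -/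
theorem exists_collection (hval : IsTruthValue N val) (x : Name A)
    {P : Name A → Name A → Carrier A} (hP : ∀ z, Extensional val fun y => P y z) :
    ∃ w, ⨅ y, (memv val y x ⇨ ⨆ z, P y z) ≤
      ⨅ y, (memv val y x ⇨ ⨆ z, memv val z w ⊓ P y z) := by
  obtain ⟨e, -⟩ := hval.exists_empty
  -- One name is chosen for each `y` and each truth value that `P y` attains; these pairs form a
  -- small set because `A` is one. The empty name `e` is only a default for values not attained.
  have : ∀ q : x.dom × Carrier A, ∃ z, (∃ z', P q.1 z' = q.2) → P q.1 z = q.2 := fun q => by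
    by_cases h : ∃ z', P q.1 z' = q.2
    · exact ⟨h.choose, fun _ => h.choose_spec⟩
    · exact ⟨e, fun h' => absurd h' h⟩
  choose f hf using this
  refine ⟨Name.mk (Set.range f) fun _ => ⊤, ?_⟩
  rw [hval.iInf_memv_himp (Extensional.iSup hP), hval.iInf_memv_himp (Extensional.iSup fun z =>
    Extensional.inf (fun _ _ => inf_le_right) (hP z))]
  -- Any `z` may be replaced by `f (y, P y z)`, where `P y` has the same value and which belongs to
  -- the new name with value `1`.
  refine iInf_mono fun y => himp_le_himp_left (iSup_le fun z => ?_)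
  refine le_iSup_of_le (f (y, P y z)) (le_inf ?_ ?_)
  · exact le_top.trans (hval.app_le_memv_mk (p := fun _ => ⊤) ⟨_, Set.mem_range_self _⟩)
  · exact (hf (y, P y z) ⟨z, rfl⟩).ge

/-- A predicate whose set-theoretic progressivity has at least the value `c`, has everywhere at
least the value `c`. -/
theorem le_of_progressive (hval : IsTruthValue N val) {P : Name A → Carrier A}
    (hP : Extensional val P) {c : Carrier A}
    (h : ∀ x, c ≤ (⨅ y, (memv val y x ⇨ P y)) ⇨ P x) (x : Name A) : c ≤ P x := by
  induction x using Name.induction with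
  | h x ih =>
    have h1 : c ≤ ⨅ y, (memv val y x ⇨ P y) := by
      rw [hval.iInf_memv_himp hP]
      exact le_iInf fun y => (ih y y.2).trans le_himp
    exact (le_inf le_rfl h1).trans (le_himp_iff.1 (h x))

end IsTruthValue

end Extensional

/-! ## Validity of the axioms -/

namespace IsTruthValue

variable {A : ZFSet.{u}} [Order.Frame (Carrier A)] {N : Carrier A → Set (Carrier A)}
  {val : Sentence A → Carrier A} {n : ℕ}

theorem eval_iff (hval : IsTruthValue N val) (ρ : Fin n → Name A) (φ ψ : Fml A n) :
    (φ.iff ψ).eval val ρ =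
      (φ.eval val ρ ⇨ ψ.eval val ρ) ⊓ (ψ.eval val ρ ⇨ φ.eval val ρ) := by
  rw [Fml.iff, hval.eval_and, hval.eval_imp, hval.eval_imp]

theorem eval_exIn (hval : IsTruthValue N val) (ρ : Fin n → Name A) (t : Tm A n)
    (φ : Fml A (n + 1)) : (Fml.exIn t φ).eval val ρ =
      ⨆ a, memv val a (t.eval ρ) ⊓ φ.eval val (extend ρ a) := by
  simp only [Fml.exIn, hval.eval_ex, hval.eval_and, Fml.eval_mem, Tm.eval_var, extend_last,
    Tm.eval_weaken]

theorem eval_allIn (hval : IsTruthValue N val) (ρ : Fin n → Name A) (t : Tm A n)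
    (φ : Fml A (n + 1)) : (Fml.allIn t φ).eval val ρ =
      ⨅ a, (memv val a (t.eval ρ) ⇨ φ.eval val (extend ρ a)) := by
  simp only [Fml.allIn, hval.eval_all, hval.eval_imp, Fml.eval_mem, Tm.eval_var, extend_last,
    Tm.eval_weaken]

theorem himp_inf_himp_eq_top {H : Type*} [GeneralizedHeytingAlgebra H] {a b : H} (h : a = b) :
    (a ⇨ b) ⊓ (b ⇨ a) = ⊤ := by
  simp [h]

/-- Since `⟦t ≈ t⟧ = 1`, explosion forces the value of the negation to `0`, although negation is not
truth-functional. This is where N3 rather than N4 matters. -/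
theorem eval_neg_eq_self (hval : IsTruthValue N val) (hN : IsN3Structure N) (ρ : Fin n → Name A)
    (t : Tm A n) : (Fml.neg (.eq t t)).eval val ρ = ⊥ := by
  have h := hN.explosion _ _ (hval.neg_mem ((Fml.eq t t).subst fun i => .name (ρ i)))
  have e : val ((Fml.eq t t).subst fun i => .name (ρ i)) = ⊤ :=
    (Fml.eval_eq val ρ t t).trans (hval.eqv_self _)
  rwa [e, top_inf_eq] at h

theorem eval_isEmpty (hval : IsTruthValue N val) (hN : IsN3Structure N) (ρ : Fin n → Name A)
    (t : Tm A n) (h : ∀ z, memv val z (t.eval ρ) = ⊥) : (isEmpty t).eval val ρ = ⊤ := by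
  rw [isEmpty, hval.eval_all, iInf_eq_top]
  intro z
  rw [hval.eval_iff, hval.eval_neg_eq_self hN, Fml.eval_mem, Tm.eval_weaken, Tm.eval_var,
    extend_mk_self]
  exact himp_inf_himp_eq_top (h z)

theorem eval_isSucc (hval : IsTruthValue N val) (ρ : Fin n → Name A) (s t : Tm A n)
    (h : ∀ z, memv val z (s.eval ρ) = memv val z (t.eval ρ) ⊔ eqv val z (t.eval ρ)) :
    (isSucc s t).eval val ρ = ⊤ := by
  rw [isSucc, hval.eval_all, iInf_eq_top]
  intro z
  rw [hval.eval_iff, hval.eval_or, Fml.eval_mem, Fml.eval_mem, Fml.eval_eq, Tm.eval_weaken,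
    Tm.eval_weaken, Tm.eval_var, extend_mk_self]
  exact himp_inf_himp_eq_top (h z)

theorem iSup_eq_top_of {ι L : Type*} [CompleteLattice L] {f : ι → L} (i : ι) (h : f i = ⊤) :
    ⨆ i, f i = ⊤ :=
  top_le_iff.1 (h ▸ le_iSup f i)

/-! ### The nine axioms -/

theorem valid_extensionality (hval : IsTruthValue N val) : Valid val (extensionality A) := by
  refine hval.valid_closure (n := 0) _ fun ρ => ?_
  simp only [hval.eval_all, hval.eval_imp, hval.eval_iff, Fml.eval_mem,
    Fml.eval_eq, Tm.eval_var, extend_mk_self]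
  refine iInf_eq_top.2 fun x => iInf_eq_top.2 fun y => himp_eq_top_iff.2 ?_
  exact hval.le_eqv
    (fun z => le_himp_iff.1 ((iInf_le _ z).trans inf_le_left))
    (fun z => le_himp_iff.1 ((iInf_le _ z).trans inf_le_right))

theorem valid_pairing (hval : IsTruthValue N val) : Valid val (pairing A) := by
  refine hval.valid_closure (n := 0) _ fun ρ => ?_
  simp only [hval.eval_all, hval.eval_ex, hval.eval_iff, hval.eval_or, Fml.eval_mem,
    Fml.eval_eq, Tm.eval_var, extend_mk_self]
  refine iInf_eq_top.2 fun x => iInf_eq_top.2 fun y => ?_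
  obtain ⟨w, hw⟩ := hval.exists_pair x y
  exact iSup_eq_top_of w (iInf_eq_top.2 fun z => himp_inf_himp_eq_top (hw z))

theorem valid_powerset (hval : IsTruthValue N val) : Valid val (powerset A) := by
  refine hval.valid_closure (n := 0) _ fun ρ => ?_
  simp only [hval.eval_all, hval.eval_ex, hval.eval_iff, hval.eval_allIn, Fml.eval_mem,
    Tm.eval_var, extend_mk_self]
  refine iInf_eq_top.2 fun x => ?_
  obtain ⟨w, hw⟩ := hval.exists_powerset x
  exact iSup_eq_top_of w (iInf_eq_top.2 fun z => himp_inf_himp_eq_top (hw z))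

theorem valid_union (hval : IsTruthValue N val) : Valid val (union A) := by
  refine hval.valid_closure (n := 0) _ fun ρ => ?_
  simp only [hval.eval_all, hval.eval_ex, hval.eval_iff, hval.eval_exIn, Fml.eval_mem,
    Tm.eval_var, extend_mk_self]
  refine iInf_eq_top.2 fun x => ?_
  obtain ⟨w, hw⟩ := hval.exists_union x
  exact iSup_eq_top_of w (iInf_eq_top.2 fun z => himp_inf_himp_eq_top (hw z))

theorem valid_emptySet (hval : IsTruthValue N val) (hN : IsN3Structure N) :
    Valid val (emptySet A) := by
  refine hval.valid_closure (n := 0) _ fun ρ => ?_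
  rw [hval.eval_ex]
  obtain ⟨w, hw⟩ := hval.exists_empty
  exact iSup_eq_top_of w (hval.eval_isEmpty hN _ _ hw)

theorem valid_infinity (hval : IsTruthValue N val) (hN : IsN3Structure N) :
    Valid val (infinity A) := by
  refine hval.valid_closure (n := 0) _ fun ρ => ?_
  obtain ⟨e, he⟩ := hval.exists_empty
  choose s hs using hval.exists_succ
  -- The numerals: iterates of a chosen successor operation on an empty name, all put into `w` with
  -- value `1`.
  set S : Set (Name A) := Set.range fun k : ℕ => s^[k] e with hS
  set w : Name A := Name.mk S fun _ => ⊤ with hw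
  have mem : ∀ k, memv val (s^[k] e) w = ⊤ := fun k =>
    top_le_iff.1 (hval.app_le_memv_mk (S := S) (p := fun _ => ⊤) ⟨_, k, rfl⟩)
  rw [hval.eval_ex]
  refine iSup_eq_top_of w ?_
  rw [hval.eval_and, hval.eval_exIn, hval.eval_allIn, inf_eq_top_iff]
  have hv : (v 0 : Tm A 1).eval (extend ρ w) = w := extend_mk_self _ _ _
  rw [hv]
  constructor
  · refine iSup_eq_top_of e ?_
    rw [hval.eval_isEmpty hN, inf_top_eq]
    · exact mem 0
    · intro z
      rw [Tm.eval_var, extend_mk_self]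
      exact he z
  -- By extensionality it suffices to treat the numerals themselves, and the successor of each is
  -- the next one.
  · rw [hval.iInf_memv_himp (hval.extensional_eval _ _), iInf_eq_top]
    rintro ⟨y, hy⟩
    obtain ⟨k, rfl⟩ := Name.mem_dom_mk.1 hy
    refine himp_eq_top_iff.2 (le_top.trans_eq (Eq.symm ?_))
    rw [hval.eval_exIn]
    refine iSup_eq_top_of (s (s^[k] e)) ?_
    rw [hval.eval_isSucc, inf_top_eq]
    · simp only [Tm.eval_var]
      rw [← Function.iterate_succ_apply' s k e]
      exact mem (k + 1)
    · simp only [Tm.eval_var, extend_mk_self]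
      exact hs _

theorem valid_separation (hval : IsTruthValue N val) {k : ℕ} (φ : Fml A (k + 2)) :
    Valid val (separation φ) := by
  refine hval.valid_closure _ fun ρ => ?_
  rw [hval.eval_all, iInf_eq_top]
  intro x
  -- The predicate `z ∈ x ∧ φ(z)` lies below `z ∈ x`, so `x.dom` supports it.
  obtain ⟨w, hw⟩ := hval.exists_memv_eq_of_le
    ((hval.extensional_memv_left x).inf (hval.extensional_eval φ (extend ρ x))) x
    fun _ => inf_le_left
  rw [hval.eval_ex]
  refine iSup_eq_top_of w ?_
  rw [hval.eval_all, iInf_eq_top]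
  intro z
  rw [hval.eval_iff, hval.eval_and, Fml.eval_skip_extend]
  refine himp_inf_himp_eq_top ?_
  have hk : k < k + 2 := by omega
  simp only [Fml.eval_mem, Tm.eval_var, extend_mk_self, extend_mk_lt, Nat.lt_succ_self, hk, hw]

theorem valid_collection (hval : IsTruthValue N val) {k : ℕ} (φ : Fml A (k + 3)) :
    Valid val (collection φ) := by
  refine hval.valid_closure _ fun ρ => ?_
  rw [hval.eval_all, iInf_eq_top]
  intro x
  obtain ⟨w, hw⟩ := hval.exists_collection x
    (P := fun y z => φ.eval val (extend (extend (extend ρ x) y) z))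
    fun z => hval.extensional_eval_extend φ (extend ρ x) z
  rw [hval.eval_imp, himp_eq_top_iff, hval.eval_ex]
  refine le_iSup_of_le w ?_
  simp only [hval.eval_allIn, hval.eval_exIn, hval.eval_ex, Fml.eval_skip_extend_extend,
    Tm.eval_var, extend_mk_self, extend_mk_lt, Nat.lt_succ_self]
  exact hw

theorem valid_induction (hval : IsTruthValue N val) {k : ℕ} (φ : Fml A (k + 1)) :
    Valid val (induction φ) := by
  refine hval.valid_closure _ fun ρ => ?_
  rw [hval.eval_imp, himp_eq_top_iff, hval.eval_all, hval.eval_all]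
  -- Here `c` is the value of the premise, the meet over all names.
  refine le_iInf fun x => hval.le_of_progressive (hval.extensional_eval φ ρ) (fun y => ?_) x
  refine (iInf_le _ y).trans ?_
  simp only [hval.eval_imp, hval.eval_allIn, Fml.eval_skip_extend, Tm.eval_var, extend_mk_self]
  exact le_rfl

end IsTruthValue

end N3Model

theorem mainTheorem4 (A : ZFSet.{u}) [Order.Frame (N3Model.Carrier A)]
    (N : N3Model.Carrier A → Set (N3Model.Carrier A)) (hN : N3Model.IsN3Structure N)
    (val : N3Model.Sentence A → N3Model.Carrier A) (hval : N3Model.IsTruthValue N val)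
    (φ : N3Model.Sentence A) (hφ : N3Model.ZFAxiom A φ) : N3Model.Valid val φ := by
  cases hφ with
  | extensionality => exact hval.valid_extensionality
  | pairing => exact hval.valid_pairing
  | collection φ => exact hval.valid_collection φ
  | powerset => exact hval.valid_powerset
  | separation φ => exact hval.valid_separation φ
  | emptySet => exact hval.valid_emptySet hN
  | union => exact hval.valid_union
  | infinity => exact hval.valid_infinity hN
  | induction φ => exact hval.valid_induction φ
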